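/- Call a homogeneous polynomial a form. For a real polynomial $f$ in $n$ variables let $H_f(x)$ denote its Hessian matrix, and for an integer $r\ge 0$ call $f$ *$r$-sos-convex* if $y^TH_f(x)y\cdot\big(\sum_{i=1}^n x_i^2\big)^r$ is a sum of squares of real polynomials in $(x,y)=(x_1,\dots,x_n,y_1,\dots,y_n)$. **Theorem.** (1) For every integer $r\ge 0$ there exists a real form $f$ in $3$ variables and of degree $8$ such that $H_f(x)\succ 0$ for all $x\neq 0$, but $f$ is not $r$-sos-convex. (2) These forms can be taken to be rescalings of a single octic: there is a real form $f$ in $3$ variables and of degree $8$ with $H_f(x)\succ0$ for all $x\ne0$ such that for every integer $r\ge 0$ there is an integer $s\ge 1$ for which the octic form $g_s(x_1,x_2,x_3)=f(x_1,s x_2,s x_3)$ satisfies $H_{g_s}(x)\succ 0$ for all $x\neq 0$ and is not $r$-sos-convex. (3) Consequently the level $r$ cannot be bounded in terms of $n$ and $d$ alone: there is no function $R:\mathbb N\times\mathbb N\to\mathbb N$ such that every real form $f$ in $n$ variables and of degree $d$ with $H_f(x)\succ 0$ for all $x\neq 0$ is $r$-sos-convex for some $r\le R(n,d)$. -/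

import Mathlib

namespace PolyNorm

noncomputable section

open MvPolynomial

/-- The Hessian matrix of a polynomial, with polynomial entries. -/
def hessian {n : ℕ} (f : MvPolynomial (Fin n) ℝ) :
    Matrix (Fin n) (Fin n) (MvPolynomial (Fin n) ℝ) :=
  Matrix.of fun i j => pderiv i (pderiv j f)

/-- The Hessian matrix of `f` evaluated at the point `x`. -/
def hessianAt {n : ℕ} (f : MvPolynomial (Fin n) ℝ) (x : Fin n → ℝ) :
    Matrix (Fin n) (Fin n) ℝ :=
  (hessian f).map (eval x)

/-- The Hessian of `f` is positive definite at every nonzero point. -/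
def HasPosDefHessian {n : ℕ} (f : MvPolynomial (Fin n) ℝ) : Prop :=
  ∀ x : Fin n → ℝ, x ≠ 0 → (hessianAt f x).PosDef

/-- The biform `yᵀ H_f(x) y` as a polynomial in `(x, y)`: the variable `x i` is `X (Sum.inl i)`
and the variable `y i` is `X (Sum.inr i)`. -/
def hessianBiform {n : ℕ} (f : MvPolynomial (Fin n) ℝ) :
    MvPolynomial (Fin n ⊕ Fin n) ℝ :=
  ∑ i, ∑ j, X (Sum.inr i) * rename Sum.inl (hessian f i j) * X (Sum.inr j)

/-- `f` is `r`-sos-convex: `yᵀ H_f(x) y · (∑ i, x i ^ 2) ^ r` is a sum of squares of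
polynomials in `(x, y)`. -/
def IsRSosConvex {n : ℕ} (r : ℕ) (f : MvPolynomial (Fin n) ℝ) : Prop :=
  IsSumSq (hessianBiform f * (∑ i : Fin n, X (Sum.inl i) ^ 2) ^ r)

/-- The polynomial `f(x₁, s x₂, s x₃)`. -/
def rescale (s : ℕ) (f : MvPolynomial (Fin 3) ℝ) : MvPolynomial (Fin 3) ℝ :=
  bind₁ ![X 0, C (s : ℝ) * X 1, C (s : ℝ) * X 2] f

end

end PolyNorm

namespace PolyNorm

noncomputable section

open MvPolynomial

/-! In direction `y = (1, 0, 0)` the Hessian biform of the octic is a perturbed Motzkin form,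
whatever `K` is, and a large `K` makes the Hessian positive definite (`exists_biform_pos`). If the
rescaled octic were `r`-sos-convex, undoing the scaling and setting `x₀ = 1` would make `motzkin 1 u
v * (1 + (u² + v²) / s²) ^ r` a sum of squares `∑ q_j²`. For fixed `r` this multiplier tends to `1`
on bounded sets as `s` grows, so the `q_j` are nearly cubics.

A nine-point functional that annihilates cubics (`cubature`) makes this quantitative. It would
express `q_j(0)`, up to a small error, through values at `(±1, ±1)`, where the Motzkin form vanishes
and its perturbation is tiny, and at `(±3, 0)`, `(0, ±3)`, where it is too small to account for `∑
q_j(0)² = 1`. This contradiction is `exists_motzkin_mul_ne_sum_sq`. Since `K` does not depend on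
`s`, a single octic serves every `r`; the absence of a bound follows by monotonicity in `r`. -/

/-- The octic form `F(x₀, s x₁, s x₂) + K s⁸ (x₁² + x₂²)⁴`, where the second derivative of `F` in
the first variable is a positive definite perturbation of the Motzkin form. -/
def octic (K s : ℝ) : MvPolynomial (Fin 3) ℝ :=
  C (1 / 56) * X 0 ^ 8 + C (-(1 / 4)) * (X 0 ^ 4 * (C s * X 1) ^ 2 * (C s * X 2) ^ 2)
    + C (1 / 2) * (X 0 ^ 2 * (C s * X 1) ^ 4 * (C s * X 2) ^ 2)
    + C (1 / 2) * (X 0 ^ 2 * (C s * X 1) ^ 2 * (C s * X 2) ^ 4)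
    + C (1 / 30000) * (X 0 ^ 6 * (C s * X 1) ^ 2) + C (1 / 30000) * (X 0 ^ 6 * (C s * X 2) ^ 2)
    + C (1 / 2000) * (X 0 ^ 2 * (C s * X 1) ^ 6) + C (1 / 2000) * (X 0 ^ 2 * (C s * X 2) ^ 6)
    + C K * ((C s * X 1) ^ 2 + (C s * X 2) ^ 2) ^ 4

/-- The perturbed Motzkin form. -/
def motzkin (x u v : ℝ) : ℝ :=
  x ^ 6 - 3 * x ^ 2 * u ^ 2 * v ^ 2 + u ^ 4 * v ^ 2 + u ^ 2 * v ^ 4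
    + (x ^ 4 * (u ^ 2 + v ^ 2) + u ^ 6 + v ^ 6) / 1000

/-- The Hessian biform of the part of `octic` that does not involve `K`, for `s = 1`. -/
def mainBiform (x u v a b c : ℝ) : ℝ :=
  motzkin x u v * a ^ 2
    + 2 * a * b * (-2 * x ^ 3 * u * v ^ 2 + x * (4 * u ^ 3 * v ^ 2 + 2 * u * v ^ 4)
      + (2 / 5 * x ^ 5 * u + 6 * x * u ^ 5) / 1000)
    + 2 * a * c * (-2 * x ^ 3 * u ^ 2 * v + x * (4 * u ^ 2 * v ^ 3 + 2 * u ^ 4 * v)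
      + (2 / 5 * x ^ 5 * v + 6 * x * v ^ 5) / 1000)
    + b ^ 2 * (-(1 / 2) * x ^ 4 * v ^ 2 + x ^ 2 * (6 * u ^ 2 * v ^ 2 + v ^ 4)
      + (x ^ 6 / 15 + 15 * x ^ 2 * u ^ 4) / 1000)
    + c ^ 2 * (-(1 / 2) * x ^ 4 * u ^ 2 + x ^ 2 * (6 * u ^ 2 * v ^ 2 + u ^ 4)
      + (x ^ 6 / 15 + 15 * x ^ 2 * v ^ 4) / 1000)
    + 2 * b * c * (-x ^ 4 * u * v + 4 * x ^ 2 * (u ^ 3 * v + u * v ^ 3))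

/-- The Hessian biform of `(u² + v²)⁴`. -/
def radialBiform (u v b c : ℝ) : ℝ :=
  8 * (u ^ 2 + v ^ 2) ^ 3 * (b ^ 2 + c ^ 2) + 48 * (u ^ 2 + v ^ 2) ^ 2 * (u * b + v * c) ^ 2

/-! ### The octic and its Hessian biform. -/

lemma octic_isHomogeneous (K s : ℝ) : (octic K s).IsHomogeneous 8 := by
  have h1 : (C s * X 1 : MvPolynomial (Fin 3) ℝ).IsHomogeneous 1 := by
    simpa using (isHomogeneous_C (Fin 3) s).mul (isHomogeneous_X ℝ 1)
  have h2 : (C s * X 2 : MvPolynomial (Fin 3) ℝ).IsHomogeneous 1 := by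
    simpa using (isHomogeneous_C (Fin 3) s).mul (isHomogeneous_X ℝ 2)
  have h0 := isHomogeneous_X ℝ (0 : Fin 3)
  have hc : ∀ (c : ℝ) {p : MvPolynomial (Fin 3) ℝ}, p.IsHomogeneous 8 →
      (C c * p).IsHomogeneous 8 := fun c p hp => by
    simpa using (isHomogeneous_C (Fin 3) c).mul hp
  refine (((((((((hc _ ?_).add (hc _ ?_)).add (hc _ ?_)).add (hc _ ?_)).add (hc _ ?_)).add
    (hc _ ?_)).add (hc _ ?_)).add (hc _ ?_)).add (hc _ ?_))
  · exact h0.pow 8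
  · exact ((h0.pow 4).mul (h1.pow 2)).mul (h2.pow 2)
  · exact ((h0.pow 2).mul (h1.pow 4)).mul (h2.pow 2)
  · exact ((h0.pow 2).mul (h1.pow 2)).mul (h2.pow 4)
  · exact (h0.pow 6).mul (h1.pow 2)
  · exact (h0.pow 6).mul (h2.pow 2)
  · exact (h0.pow 2).mul (h1.pow 6)
  · exact (h0.pow 2).mul (h2.pow 6)
  · exact ((h1.pow 2).add (h2.pow 2)).pow 4

lemma rescale_octic (K : ℝ) (s : ℕ) : rescale s (octic K 1) = octic K s := by
  simp [rescale, octic]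

lemma eval_hessianBiform {n : ℕ} (f : MvPolynomial (Fin n) ℝ) (x y : Fin n → ℝ) :
    eval (Sum.elim x y) (hessianBiform f) = ∑ i, ∑ j, y i * hessianAt f x i j * y j := by
  simp [hessianBiform, hessianAt, eval_rename]

lemma hessianAt_octic (K s : ℝ) (x y : Fin 3 → ℝ) :
    ∑ i, ∑ j, y i * hessianAt (octic K s) x i j * y j =
      mainBiform (x 0) (s * x 1) (s * x 2) (y 0) (s * y 1) (s * y 2)
        + K * radialBiform (s * x 1) (s * x 2) (s * y 1) (s * y 2) := by
  simp only [Fin.sum_univ_three, hessianAt, hessian, octic, Matrix.map_apply, Matrix.of_apply]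
  have hn : ∀ (i : Fin 3) (k : ℕ) [k.AtLeastTwo],
      pderiv i (OfNat.ofNat k : MvPolynomial (Fin 3) ℝ) = 0 := fun i k _ =>
    (pderiv i).map_natCast k
  simp [Derivation.leibniz_pow, pderiv_X, Derivation.leibniz, hn]
  simp only [mainBiform, radialBiform, motzkin]
  ring

lemma hessian_isHermitian {n : ℕ} (f : MvPolynomial (Fin n) ℝ) (x : Fin n → ℝ) :
    (hessianAt f x).IsHermitian := by
  ext i j
  -- The commutator is itself a derivation, so it suffices that it kills the variables.
  have h : ⁅pderiv (R := ℝ) i, pderiv (R := ℝ) j⁆ = 0 := by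
    ext k
    simp [Derivation.commutator_apply, pderiv_X, Pi.single_apply, apply_ite]
  have h' := DFunLike.congr_fun h f
  rw [Derivation.commutator_apply, Derivation.zero_apply, sub_eq_zero] at h'
  simp [hessianAt, hessian, h']

/-! ### Positive definiteness of the Hessian for large `K`. -/

lemma motzkin_pos {x u v : ℝ} (h : x ≠ 0 ∨ u ≠ 0 ∨ v ≠ 0) : 0 < motzkin x u v := by
  have key : ∀ A B D : ℝ, 0 ≤ A → 0 ≤ B → 0 ≤ D →
      0 ≤ A ^ 3 - 3 * A * B * D + B ^ 2 * D + B * D ^ 2 := by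
    intro A B D hA hB hD
    have hP : 0 ≤ B * D := mul_nonneg hB hD
    rcases le_total (3 * A) (B + D) with hc | hc
    · nlinarith [mul_nonneg hP (sub_nonneg.2 hc), pow_nonneg hA 3]
    -- With `S = B + D`, four times the expression is `(3A - S)(B - D)² + (A + S)(2A - S)²`.
    · nlinarith [mul_nonneg (sub_nonneg.2 hc) (sq_nonneg (B - D)),
        mul_nonneg (add_nonneg hA (add_nonneg hB hD)) (sq_nonneg (2 * A - (B + D)))]
  have h1 := key (x ^ 2) (u ^ 2) (v ^ 2) (by positivity) (by positivity) (by positivity)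
  have h2 : 0 ≤ x ^ 4 * (u ^ 2 + v ^ 2) := by positivity
  by_cases hu : u = 0
  · by_cases hv : v = 0
    · have hx : x ≠ 0 := by simpa [hu, hv] using h
      subst hu hv
      have : motzkin x 0 0 = x ^ 6 := by simp [motzkin]
      rw [this]
      positivity
    · have h3 : 0 < v ^ 6 := by positivity
      have h4 : 0 ≤ u ^ 6 := by positivity
      unfold motzkin
      nlinarith
  · have h3 : 0 < u ^ 6 := by positivity
    have h4 : 0 ≤ v ^ 6 := by positivity
    unfold motzkin
    nlinarith

lemma radialBiform_nonneg (u v b c : ℝ) : 0 ≤ radialBiform u v b c := by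
  unfold radialBiform
  positivity

/-- The radial biform vanishes only if `u = v = 0` or `b = c = 0`. The terms `x⁶u²`, `x⁶v²` of the
octic settle the first case, positivity of the perturbed Motzkin form the second. -/
lemma mainBiform_pos_of_radialBiform_eq_zero {x u v a b c : ℝ}
    (hx : x ≠ 0 ∨ u ≠ 0 ∨ v ≠ 0) (hy : a ≠ 0 ∨ b ≠ 0 ∨ c ≠ 0) (h : radialBiform u v b c = 0) :
    0 < mainBiform x u v a b c := by
  by_cases hz : u = 0 ∧ v = 0
  · obtain ⟨rfl, rfl⟩ := hz
    have hx : 0 < x ^ 6 := by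
      have : x ≠ 0 := by simpa using hx
      positivity
    have : mainBiform x 0 0 a b c = x ^ 6 * (a ^ 2 + (b ^ 2 + c ^ 2) / 15000) := by
      simp only [mainBiform, motzkin]
      ring
    rw [this]
    refine mul_pos hx ?_
    rcases hy with h | h | h <;> positivity
  · have hn : 0 < u ^ 2 + v ^ 2 := by
      by_cases hu : u = 0
      · have : v ≠ 0 := fun hv => hz ⟨hu, hv⟩
        positivity
      · positivity
    have hbc : b ^ 2 + c ^ 2 = 0 := by
      have h1 : 0 ≤ 48 * (u ^ 2 + v ^ 2) ^ 2 * (u * b + v * c) ^ 2 := by positivity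
      have h2 : 0 ≤ 8 * (u ^ 2 + v ^ 2) ^ 3 * (b ^ 2 + c ^ 2) := by positivity
      have h3 : 8 * (u ^ 2 + v ^ 2) ^ 3 * (b ^ 2 + c ^ 2) = 0 := by
        unfold radialBiform at h
        linarith
      exact (mul_eq_zero.1 h3).resolve_left (by positivity)
    have hb : b = 0 := by nlinarith [sq_nonneg b, sq_nonneg c]
    have hc : c = 0 := by nlinarith [sq_nonneg b, sq_nonneg c]
    subst hb hc
    have ha : a ≠ 0 := by simpa using hy
    have : mainBiform x u v a 0 0 = motzkin x u v * a ^ 2 := by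
      simp only [mainBiform]
      ring
    rw [this]
    exact mul_pos (motzkin_pos hx) (by positivity)

/-- On the compact set where `f ≤ 0`, `g` has a positive minimum, so a large multiple of it
outweighs the minimum of `f`. -/
lemma _root_.IsCompact.exists_forall_add_mul_pos {α : Type*} [TopologicalSpace α] {S : Set α}
    (hS : IsCompact S) {f g : α → ℝ} (hf : Continuous f) (hg : Continuous g)
    (hg0 : ∀ p, 0 ≤ g p) (h : ∀ p ∈ S, g p = 0 → 0 < f p) :
    ∃ K : ℝ, ∀ p ∈ S, 0 < f p + K * g p := by
  have hT : IsCompact (S ∩ {p | f p ≤ 0}) := hS.inter_right (isClosed_le hf continuous_const)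
  rcases (S ∩ {p | f p ≤ 0}).eq_empty_or_nonempty with he | hne
  · refine ⟨0, fun p hp => ?_⟩
    by_contra hc
    have : p ∈ S ∩ {p | f p ≤ 0} := ⟨hp, by simpa using hc⟩
    simp [he] at this
  · obtain ⟨p₀, hp₀, hm⟩ := hT.exists_isMinOn hne hg.continuousOn
    obtain ⟨p₁, hp₁, hl⟩ := hT.exists_isMinOn hne hf.continuousOn
    have hpos : 0 < g p₀ := lt_of_le_of_ne (hg0 _) fun h0 =>
      absurd (h p₀ hp₀.1 h0.symm) (not_lt.2 hp₀.2)
    refine ⟨(1 - f p₁) / g p₀, fun p hp => ?_⟩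
    have hK : 0 ≤ (1 - f p₁) / g p₀ := div_nonneg (by linarith [hp₁.2.out]) hpos.le
    by_cases hfp : f p ≤ 0
    · have h1 : g p₀ ≤ g p := hm ⟨hp, hfp⟩
      have h2 : f p₁ ≤ f p := hl ⟨hp, hfp⟩
      have h3 := mul_le_mul_of_nonneg_left h1 hK
      rw [div_mul_cancel₀ _ hpos.ne'] at h3
      linarith
    · have := mul_nonneg hK (hg0 p)
      linarith

lemma ne_zero_iff_fin_three {x : Fin 3 → ℝ} : x ≠ 0 ↔ x 0 ≠ 0 ∨ x 1 ≠ 0 ∨ x 2 ≠ 0 := by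
  rw [Function.ne_iff]
  simp [Fin.exists_fin_succ]

lemma exists_biform_pos : ∃ K : ℝ, ∀ x y : Fin 3 → ℝ, x ≠ 0 → y ≠ 0 →
    0 < mainBiform (x 0) (x 1) (x 2) (y 0) (y 1) (y 2)
      + K * radialBiform (x 1) (x 2) (y 1) (y 2) := by
  have hS := (isCompact_sphere (0 : Fin 3 → ℝ) 1).prod (isCompact_sphere (0 : Fin 3 → ℝ) 1)
  obtain ⟨K, hK⟩ := hS.exists_forall_add_mul_pos
    (f := fun p => mainBiform (p.1 0) (p.1 1) (p.1 2) (p.2 0) (p.2 1) (p.2 2))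
    (g := fun p => radialBiform (p.1 1) (p.1 2) (p.2 1) (p.2 2))
    (by unfold mainBiform motzkin; fun_prop) (by unfold radialBiform; fun_prop)
    (fun p => radialBiform_nonneg _ _ _ _) (fun p hp h => by
      have h1 : p.1 ≠ 0 := ne_zero_of_mem_unit_sphere ⟨p.1, hp.1⟩
      have h2 : p.2 ≠ 0 := ne_zero_of_mem_unit_sphere ⟨p.2, hp.2⟩
      exact mainBiform_pos_of_radialBiform_eq_zero (ne_zero_iff_fin_three.1 h1)
        (ne_zero_iff_fin_three.1 h2) h)
  refine ⟨K, fun x y hx hy => ?_⟩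
  have hx' : 0 < ‖x‖⁻¹ := by positivity
  have hy' : 0 < ‖y‖⁻¹ := by positivity
  have hp := hK (‖x‖⁻¹ • x, ‖y‖⁻¹ • y) ⟨by simp [norm_smul, hx], by simp [norm_smul, hy]⟩
  generalize ‖x‖⁻¹ = l at *
  generalize ‖y‖⁻¹ = m at *
  -- Bihomogeneity of bidegree `(6, 2)` carries positivity from the product of unit spheres to all
  -- nonzero `x`, `y`.
  have : mainBiform (l * x 0) (l * x 1) (l * x 2) (m * y 0) (m * y 1) (m * y 2)
      + K * radialBiform (l * x 1) (l * x 2) (m * y 1) (m * y 2)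
      = (l ^ 6 * m ^ 2) * (mainBiform (x 0) (x 1) (x 2) (y 0) (y 1) (y 2)
      + K * radialBiform (x 1) (x 2) (y 1) (y 2)) := by
    simp only [mainBiform, radialBiform, motzkin]
    ring
  simp only [Pi.smul_apply, smul_eq_mul, this] at hp
  exact pos_of_mul_pos_right hp (by positivity)

/-- One `K` works for all `s`, because the scaling is an invertible change of variables in both `x`
and `y`. -/
lemma exists_octic_hasPosDefHessian :
    ∃ K : ℝ, ∀ s : ℝ, s ≠ 0 → HasPosDefHessian (octic K s) := by
  obtain ⟨K, hK⟩ := exists_biform_pos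
  refine ⟨K, fun s hs x hx => .of_dotProduct_mulVec_pos (hessian_isHermitian _ _) fun y hy => ?_⟩
  have h := hK ![x 0, s * x 1, s * x 2] ![y 0, s * y 1, s * y 2]
    (ne_zero_iff_fin_three.2 (by simpa [hs] using ne_zero_iff_fin_three.1 hx))
    (ne_zero_iff_fin_three.2 (by simpa [hs] using ne_zero_iff_fin_three.1 hy))
  have h2 := hessianAt_octic K s x y
  simp only [dotProduct, Matrix.mulVec, Finset.mul_sum, star_trivial, ← mul_assoc]
  rw [h2]
  simpa using h

/-! ### A functional annihilating cubics, and the estimates around it. -/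

/-- The restriction of a bivariate polynomial to the line through the origin spanned by `(a, b)`. -/
def restrict (a b : ℝ) : MvPolynomial (Fin 2) ℝ →ₐ[ℝ] Polynomial ℝ :=
  aeval ![Polynomial.C a * Polynomial.X, Polynomial.C b * Polynomial.X]

lemma eval_restrict (a b t : ℝ) (q : MvPolynomial (Fin 2) ℝ) :
    (restrict a b q).eval t = eval ![a * t, b * t] q := by
  have : (Polynomial.evalRingHom t).comp (restrict a b : MvPolynomial (Fin 2) ℝ →+* _)
      = eval ![a * t, b * t] := by
    ext i
    · simp
    · fin_cases i <;> simp [restrict]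
  exact congr($this q)

/-- A combination of values of `q` at nine points, dilated by a parameter; it
annihilates cubics. -/
def cubature : MvPolynomial (Fin 2) ℝ →ₗ[ℝ] Polynomial ℝ :=
  (28 : ℝ) • (restrict 0 0).toLinearMap
    - (9 : ℝ) • ((restrict 1 1).toLinearMap + (restrict 1 (-1)).toLinearMap
      + (restrict (-1) 1).toLinearMap + (restrict (-1) (-1)).toLinearMap)
    + (2 : ℝ) • ((restrict 3 0).toLinearMap + (restrict (-3) 0).toLinearMap
      + (restrict 0 3).toLinearMap + (restrict 0 (-3)).toLinearMap)

lemma eval_cubature (q : MvPolynomial (Fin 2) ℝ) (t : ℝ) :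
    (cubature q).eval t = 28 * eval ![0, 0] q
      - 9 * (eval ![t, t] q + eval ![t, -t] q + eval ![-t, t] q + eval ![-t, -t] q)
      + 2 * (eval ![3 * t, 0] q + eval ![-(3 * t), 0] q + eval ![0, 3 * t] q
        + eval ![0, -(3 * t)] q) := by
  simp [cubature, eval_restrict]
  ring

lemma coeff_restrict_monomial (a b c : ℝ) (m : Fin 2 →₀ ℕ) (k : ℕ) :
    (restrict a b (monomial m c)).coeff k =
      if k = m 0 + m 1 then c * (a ^ m 0 * b ^ m 1) else 0 := by
  have : restrict a b (monomial m c)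
      = Polynomial.C (c * (a ^ m 0 * b ^ m 1)) * Polynomial.X ^ (m 0 + m 1) := by
    simp [restrict, aeval_monomial, Finsupp.prod_fintype, mul_pow, pow_add]
    ring
  rw [this, Polynomial.coeff_C_mul_X_pow]

lemma coeff_cubature (q : MvPolynomial (Fin 2) ℝ) {k : ℕ} (hk : k < 4) :
    (cubature q).coeff k = 0 := by
  induction q using MvPolynomial.induction_on' with
  | monomial m c =>
    simp only [cubature, LinearMap.add_apply, LinearMap.sub_apply, LinearMap.smul_apply,
      AlgHom.toLinearMap_apply, Polynomial.coeff_add, Polynomial.coeff_sub, Polynomial.coeff_smul,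
      coeff_restrict_monomial, smul_eq_mul]
    by_cases h : k = m 0 + m 1
    · simp only [if_pos h]
      have h0 : m 0 < 4 := by omega
      have h1 : m 1 < 4 := by omega
      generalize m 0 = i at *
      generalize m 1 = j at *
      interval_cases i <;> interval_cases j <;> first | omega | (norm_num; try ring)
    · simp [h]
  | add p q hp hq => simp [hp, hq]

/-- A polynomial of degree at most `D` whose coefficients below `4` vanish is
controlled at `1` by its values at the points `s v`, with a factor `s⁻⁴`. -/
lemma exists_eval_one_sq_le (D : ℕ) : ∃ W : ℝ, 0 ≤ W ∧ ∃ v : Fin (D + 1) → ℝ,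
    (∀ i, v i ∈ Set.Icc (0 : ℝ) 1) ∧ ∀ s : ℝ, 1 ≤ s → ∀ p : Polynomial ℝ, p.natDegree ≤ D →
      (∀ k < 4, p.coeff k = 0) →
      s ^ 8 * p.eval 1 ^ 2 ≤ W * ∑ i, p.eval (s * v i) ^ 2 := by
  set v : Fin (D + 1) → ℝ := fun i => (i : ℝ) / (D + 1) with hv
  have hinj : Set.InjOn v (Finset.univ : Finset (Fin (D + 1))) := by
    intro i _ j _ h
    have hD : (D : ℝ) + 1 ≠ 0 := by positivity
    simp only [hv, div_left_inj' hD, Nat.cast_inj] at h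
    exact Fin.ext h
  -- Interpolating `p(s·)` at the nodes `v i` gives its `k`-th coefficient, which is `s ^ k` times
  -- that of `p`. Only `k ≥ 4` contributes to `p(1)`, whence the gain `s⁻⁴`, and `s⁻⁸` after
  -- squaring.
  set w : ℕ → Fin (D + 1) → ℝ := fun k i => (Lagrange.basis Finset.univ v i).coeff k with hw
  refine ⟨∑ i, (∑ k ∈ Finset.range (D + 1), |w k i|) ^ 2, by positivity, v,
    fun i => ⟨by positivity, ?_⟩, fun s hs p hp hp4 => ?_⟩
  · rw [hv, div_le_one (by positivity)]
    have : (i : ℕ) ≤ D + 1 := i.2.le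
    exact_mod_cast this
  have hs0 : s ≠ 0 := by positivity
  set χ := p.comp (Polynomial.C s * Polynomial.X) with hχ
  have hcoef : ∀ k, χ.coeff k = p.coeff k * s ^ k := fun k => by
    rw [hχ, Polynomial.comp_C_mul_X_coeff]
  have hdeg : χ.degree < (Finset.univ : Finset (Fin (D + 1))).card := by
    rw [Finset.card_univ, Fintype.card_fin, Polynomial.degree_lt_iff_coeff_zero]
    intro k hk
    rw [hcoef, Polynomial.coeff_eq_zero_of_natDegree_lt (by omega), zero_mul]
  have hχk : ∀ k, χ.coeff k = ∑ i, p.eval (s * v i) * w k i := fun k => by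
    conv_lhs => rw [Lagrange.eq_interpolate hinj hdeg]
    simp [Lagrange.interpolate_apply, hw, hχ]
  have h1 : s ^ 4 * p.eval 1 = ∑ i, (∑ k ∈ Finset.range (D + 1), if k < 4 then 0 else
      s ^ 4 / s ^ k * w k i) * p.eval (s * v i) := by
    rw [Polynomial.eval_eq_sum_range' (Nat.lt_succ_of_le hp), Finset.mul_sum]
    simp_rw [Finset.sum_mul]
    rw [Finset.sum_comm]
    refine Finset.sum_congr rfl fun k _ => ?_
    by_cases hk : k < 4
    · simp [hk, hp4 k hk]
    · have : p.coeff k = χ.coeff k / s ^ k := by rw [hcoef]; field_simp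
      rw [this, hχk, Finset.sum_div]
      simp only [hk, if_false, one_pow, mul_one, Finset.mul_sum]
      refine Finset.sum_congr rfl fun i _ => by ring
  have h2 : s ^ 8 * p.eval 1 ^ 2 = (s ^ 4 * p.eval 1) ^ 2 := by ring
  rw [h2, h1]
  refine (Finset.sum_mul_sq_le_sq_mul_sq _ _ _).trans ?_
  refine mul_le_mul_of_nonneg_right (Finset.sum_le_sum fun i _ => sq_le_sq.2 ?_) (by positivity)
  refine le_trans ?_ (le_abs_self _)
  refine (Finset.abs_sum_le_sum_abs _ _).trans (Finset.sum_le_sum fun k _ => ?_)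
  split_ifs with hk
  · simp
  · rw [abs_mul]
    refine mul_le_of_le_one_left (abs_nonneg _) ?_
    rw [abs_of_pos (by positivity), div_le_one (by positivity)]
    exact pow_le_pow_right₀ hs (by omega)

/-- Nothing is assumed about the degrees of the squared polynomials; growth bounds the degree of
their cubature. -/
lemma natDegree_le_of_sq_le {p : Polynomial ℝ} {c : ℝ} {D : ℕ}
    (h : ∀ t : ℝ, p.eval t ^ 2 ≤ c * (1 + t ^ 2) ^ D) : p.natDegree ≤ D := by
  by_contra! hlt
  have hdeg : ((Polynomial.C c * (1 + Polynomial.X ^ 2) ^ D : Polynomial ℝ)).degree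
      < (p ^ 2).degree := by
    have h1 : (Polynomial.C c * (1 + Polynomial.X ^ 2) ^ D : Polynomial ℝ).natDegree
        ≤ 2 * D := by compute_degree; omega
    refine Polynomial.degree_lt_degree ?_
    rw [Polynomial.natDegree_pow]
    omega
  have h2 := Polynomial.isLittleO_atTop_of_degree_lt _ _ hdeg
  have h3 := h2.def (c := 1 / 2) (by norm_num)
  have hp : p ≠ 0 := by rintro rfl; simp at hlt
  obtain ⟨t, ht, hr⟩ := (h3.and (Polynomial.eventually_atTop_not_isRoot _ hp)).exists
  have h4 : 0 < p.eval t ^ 2 := by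
    have : p.eval t ≠ 0 := hr
    positivity
  simp only [Polynomial.eval_mul, Polynomial.eval_C, Polynomial.eval_pow, Polynomial.eval_add,
    Polynomial.eval_one, Polynomial.eval_X, Real.norm_eq_abs, abs_of_pos h4] at ht
  linarith [h t, le_abs_self (c * (1 + t ^ 2) ^ D)]

/-- Cauchy–Schwarz with `1124 = 28² + 4·9² + 4·2²`. -/
lemma eval_cubature_sq_le (q : MvPolynomial (Fin 2) ℝ) (t : ℝ) :
    (cubature q).eval t ^ 2 ≤ 1124 * (eval ![0, 0] q ^ 2
      + eval ![t, t] q ^ 2 + eval ![t, -t] q ^ 2 + eval ![-t, t] q ^ 2 + eval ![-t, -t] q ^ 2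
      + eval ![3 * t, 0] q ^ 2 + eval ![-(3 * t), 0] q ^ 2 + eval ![0, 3 * t] q ^ 2
      + eval ![0, -(3 * t)] q ^ 2) := by
  rw [eval_cubature]
  have h := Finset.sum_mul_sq_le_sq_mul_sq Finset.univ
    ![(28 : ℝ), -9, -9, -9, -9, 2, 2, 2, 2]
    ![eval ![0, 0] q, eval ![t, t] q, eval ![t, -t] q, eval ![-t, t] q, eval ![-t, -t] q,
      eval ![3 * t, 0] q, eval ![-(3 * t), 0] q, eval ![0, 3 * t] q, eval ![0, -(3 * t)] q]
  simp [Fin.sum_univ_succ] at h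
  norm_num at h
  refine (le_of_eq ?_).trans (h.trans (le_of_eq ?_)) <;> ring

lemma eval_zero_sq_le (q : MvPolynomial (Fin 2) ℝ) :
    784 * eval ![0, 0] q ^ 2 ≤ 3 * ((cubature q).eval 1 ^ 2
      + 324 * (eval ![1, 1] q ^ 2 + eval ![1, -1] q ^ 2 + eval ![-1, 1] q ^ 2
        + eval ![-1, -1] q ^ 2)
      + 16 * (eval ![3, 0] q ^ 2 + eval ![-3, 0] q ^ 2 + eval ![0, 3] q ^ 2
        + eval ![0, -3] q ^ 2)) := by
  have h := eval_cubature q 1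
  simp only [mul_one] at h
  have four : ∀ a b c d : ℝ, (a + b + c + d) ^ 2 ≤ 4 * (a ^ 2 + b ^ 2 + c ^ 2 + d ^ 2) := by
    intro a b c d
    nlinarith [sq_nonneg (a - b), sq_nonneg (a - c), sq_nonneg (a - d), sq_nonneg (b - c),
      sq_nonneg (b - d), sq_nonneg (c - d)]
  have h1 := four (eval ![1, 1] q) (eval ![1, -1] q) (eval ![-1, 1] q) (eval ![-1, -1] q)
  have h2 := four (eval ![3, 0] q) (eval ![-3, 0] q) (eval ![0, 3] q) (eval ![0, -3] q)
  generalize eval ![1, 1] q + eval ![1, -1] q + eval ![-1, 1] q + eval ![-1, -1] q = A at *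
  generalize eval ![3, 0] q + eval ![-3, 0] q + eval ![0, 3] q + eval ![0, -3] q = B at *
  generalize (cubature q).eval 1 = f at *
  have h3 : 28 * eval ![0, 0] q = f + 9 * A - 2 * B := by linarith
  have h4 : 784 * eval ![0, 0] q ^ 2 = (f + 9 * A - 2 * B) ^ 2 := by rw [← h3]; ring
  rw [h4]
  nlinarith [sq_nonneg (f - 9 * A), sq_nonneg (f + 2 * B), sq_nonneg (9 * A + 2 * B)]

/-! ### Failure of the sum of squares property for large `s`. -/

/-- For large `s`, the dehomogenized perturbed Motzkin form times `(1 + (u² + v²) / s²) ^ r` is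
not a sum of squares. -/
lemma exists_motzkin_mul_ne_sum_sq (r : ℕ) : ∃ s : ℕ, 1 ≤ s ∧
    ∀ (n : ℕ) (q : Fin n → MvPolynomial (Fin 2) ℝ), ¬ ∀ u v : ℝ,
      ∑ j, eval ![u, v] (q j) ^ 2 = motzkin 1 u v * (1 + (u ^ 2 + v ^ 2) / (s : ℝ) ^ 2) ^ r := by
  obtain ⟨W, hW0, v, hv, hW⟩ := exists_eval_one_sq_le (3 + r)
  have hlim : Filter.Tendsto (fun s : ℕ => (1 + 9 / (s : ℝ) ^ 2) ^ r) Filter.atTop (nhds 1) := by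
    have h : Filter.Tendsto (fun s : ℕ => 9 / (s : ℝ) ^ 2) Filter.atTop (nhds 0) :=
      Filter.Tendsto.const_div_atTop ((Filter.tendsto_pow_atTop two_ne_zero).comp
        tendsto_natCast_atTop_atTop) 9
    simpa using (h.const_add 1).pow r
  -- The first condition keeps the multiplier below `3/2` on `u² + v² ≤ 9`, which contains the nine
  -- points; the last makes the cubature error at most `1`.
  obtain ⟨s, ⟨hs32, hs1⟩, hsE⟩ := (((hlim.eventually_lt_const (by norm_num : (1 : ℝ) < 3 / 2)).and
    (Filter.eventually_ge_atTop 1)).and (tendsto_natCast_atTop_atTop.eventually_ge_atTop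
      (W * ((3 + r + 1) * (10116 * (80 * 10 ^ r)))))).exists
  refine ⟨s, hs1, fun n q hq => ?_⟩
  have hs : (1 : ℝ) ≤ s := by exact_mod_cast hs1
  generalize (s : ℝ) = s at *
  have hs2 : 1 ≤ s ^ 2 := one_le_pow₀ hs
  -- A common majorant of `∑ q_j²` at the nine points dilated by `t`; hence `10116 = 9 · 1124`
  -- below.
  set b : ℝ → ℝ := fun t => 10 * (1 + t ^ 2) ^ 3 * (1 + 9 * t ^ 2 / s ^ 2) ^ r with hb
  have hgb : ∀ t u v : ℝ, u ^ 2 + v ^ 2 ≤ 9 * t ^ 2 → motzkin 1 u v ≤ 10 * (1 + t ^ 2) ^ 3 →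
      ∑ j, eval ![u, v] (q j) ^ 2 ≤ b t := by
    intro t u v h1 h2
    rw [hq, hb]
    dsimp only
    gcongr
  have hsum : ∀ t, ∑ j, (cubature (q j)).eval t ^ 2 ≤ 10116 * b t := by
    intro t
    refine (Finset.sum_le_sum fun j _ => eval_cubature_sq_le (q j) t).trans ?_
    simp only [← Finset.mul_sum, Finset.sum_add_distrib]
    have ht : 0 ≤ t ^ 2 := sq_nonneg t
    have ht2 : 0 ≤ t ^ 4 := by positivity
    have ht3 : 0 ≤ t ^ 6 := by positivity
    have h0 := hgb t 0 0 (by nlinarith) (by unfold motzkin; nlinarith)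
    have h1 := hgb t t t (by nlinarith) (by unfold motzkin; nlinarith)
    have h2 := hgb t t (-t) (by nlinarith) (by unfold motzkin; nlinarith)
    have h3 := hgb t (-t) t (by nlinarith) (by unfold motzkin; nlinarith)
    have h4 := hgb t (-t) (-t) (by nlinarith) (by unfold motzkin; nlinarith)
    have h5 := hgb t (3 * t) 0 (by nlinarith) (by unfold motzkin; nlinarith)
    have h6 := hgb t (-(3 * t)) 0 (by nlinarith) (by unfold motzkin; nlinarith)
    have h7 := hgb t 0 (3 * t) (by nlinarith) (by unfold motzkin; nlinarith)
    have h8 := hgb t 0 (-(3 * t)) (by nlinarith) (by unfold motzkin; nlinarith)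
    linarith
  have hdeg : ∀ j, (cubature (q j)).natDegree ≤ 3 + r := fun j => by
    refine natDegree_le_of_sq_le (c := 10116 * 10 * 9 ^ r) fun t => ?_
    have h1 := Finset.single_le_sum (f := fun j => (cubature (q j)).eval t ^ 2)
      (fun j _ => sq_nonneg _) (Finset.mem_univ j)
    refine (h1.trans (hsum t)).trans ?_
    have h2 : 1 + 9 * t ^ 2 / s ^ 2 ≤ 9 * (1 + t ^ 2) := by
      have := div_le_self (show 0 ≤ 9 * t ^ 2 by positivity) hs2
      linarith
    calc 10116 * b t ≤ 10116 * (10 * (1 + t ^ 2) ^ 3 * (9 * (1 + t ^ 2)) ^ r) := by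
          rw [hb]
          dsimp only
          gcongr
      _ = 10116 * 10 * 9 ^ r * (1 + t ^ 2) ^ (3 + r) := by rw [mul_pow, pow_add]; ring
  have hbs : ∀ i, b (s * v i) ≤ 80 * 10 ^ r * s ^ 6 := by
    intro i
    have h1 : (s * v i) ^ 2 ≤ s ^ 2 := by
      rw [mul_pow]
      exact mul_le_of_le_one_right (by positivity) (pow_le_one₀ (hv i).1 (hv i).2)
    have h2 : 9 * (s * v i) ^ 2 / s ^ 2 ≤ 9 := by
      rw [div_le_iff₀ (by positivity)]
      linarith
    calc b (s * v i) ≤ 10 * (s ^ 2 + s ^ 2) ^ 3 * (1 + 9) ^ r := by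
          rw [hb]
          dsimp only
          gcongr
      _ = 80 * 10 ^ r * s ^ 6 := by norm_num; ring
  -- At the points `s * v i` the sum of squares grows only like `s⁶`, against the gain `s⁸`.
  have hone : ∑ j, (cubature (q j)).eval 1 ^ 2 ≤ 1 := by
    have h1 : s ^ 8 * ∑ j, (cubature (q j)).eval 1 ^ 2
        ≤ W * ((3 + r + 1) * (10116 * (80 * 10 ^ r))) * s ^ 6 := by
      calc s ^ 8 * ∑ j, (cubature (q j)).eval 1 ^ 2
          ≤ ∑ j, W * ∑ i, (cubature (q j)).eval (s * v i) ^ 2 := by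
            rw [Finset.mul_sum]
            exact Finset.sum_le_sum fun j _ =>
              hW s hs _ (hdeg j) fun k hk => coeff_cubature (q j) hk
        _ = W * ∑ i, ∑ j, (cubature (q j)).eval (s * v i) ^ 2 := by
            rw [← Finset.mul_sum, Finset.sum_comm]
        _ ≤ W * ∑ i : Fin (3 + r + 1), 10116 * (80 * 10 ^ r * s ^ 6) := by
            gcongr with i
            exact (hsum _).trans (by linarith [hbs i])
        _ = W * ((3 + r + 1) * (10116 * (80 * 10 ^ r))) * s ^ 6 := by
            simp
            ring
    have h2 : W * ((3 + r + 1) * (10116 * (80 * 10 ^ r))) * s ^ 6 ≤ s ^ 8 * 1 := by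
      calc _ ≤ s ^ 2 * s ^ 6 := by
            gcongr
            exact hsE.trans (by nlinarith)
        _ = s ^ 8 * 1 := by ring
    exact le_of_mul_le_mul_left (h1.trans h2) (by positivity)
  have hfin := Finset.sum_le_sum fun j (_ : j ∈ Finset.univ) => eval_zero_sq_le (q j)
  simp only [← Finset.mul_sum, Finset.sum_add_distrib, hq] at hfin
  have hle : ∀ u v m : ℝ, u ^ 2 + v ^ 2 ≤ 9 → motzkin 1 u v = m → 0 ≤ m →
      motzkin 1 u v * (1 + (u ^ 2 + v ^ 2) / s ^ 2) ^ r ≤ m * (3 / 2) := by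
    rintro u v m h1 rfl h2
    refine mul_le_mul_of_nonneg_left (le_trans ?_ hs32.le) h2
    gcongr
  have c1 := hle 1 1 (1 / 250) (by norm_num) (by norm_num [motzkin]) (by norm_num)
  have c2 := hle 1 (-1) (1 / 250) (by norm_num) (by norm_num [motzkin]) (by norm_num)
  have c3 := hle (-1) 1 (1 / 250) (by norm_num) (by norm_num [motzkin]) (by norm_num)
  have c4 := hle (-1) (-1) (1 / 250) (by norm_num) (by norm_num [motzkin]) (by norm_num)
  have a1 := hle 3 0 (869 / 500) (by norm_num) (by norm_num [motzkin]) (by norm_num)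
  have a2 := hle (-3) 0 (869 / 500) (by norm_num) (by norm_num [motzkin]) (by norm_num)
  have a3 := hle 0 3 (869 / 500) (by norm_num) (by norm_num [motzkin]) (by norm_num)
  have a4 := hle 0 (-3) (869 / 500) (by norm_num) (by norm_num [motzkin]) (by norm_num)
  have h0 : motzkin 1 0 0 * (1 + ((0 : ℝ) ^ 2 + 0 ^ 2) / s ^ 2) ^ r = 1 := by simp [motzkin]
  rw [h0] at hfin
  -- The inequality would read `784 ≤ 3 (1 + 324·4·(1/250)·(3/2) + 16·4·(869/500)·(3/2)) < 527`.
  linarith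

/-! ### From the Hessian biform to the Motzkin form, and monotonicity in `r`. -/

lemma _root_.IsSumSq.exists_sum_sq {R : Type*} [CommSemiring R] {a : R} (h : IsSumSq a) :
    ∃ (n : ℕ) (q : Fin n → R), a = ∑ j, q j ^ 2 := by
  induction h with
  | zero => exact ⟨0, Fin.elim0, by simp⟩
  | sq_add b _ ih =>
    obtain ⟨n, q, rfl⟩ := ih
    exact ⟨n + 1, Fin.cons b q, by simp [Fin.sum_univ_succ, sq]⟩

lemma exists_not_isRSosConvex_octic (K : ℝ) (r : ℕ) :
    ∃ s : ℕ, 1 ≤ s ∧ ¬ IsRSosConvex r (octic K s) := by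
  obtain ⟨s, hs, h⟩ := exists_motzkin_mul_ne_sum_sq r
  refine ⟨s, hs, fun hsos => ?_⟩
  have hs0 : (s : ℝ) ≠ 0 := by positivity
  obtain ⟨n, Q, hQ⟩ := hsos.exists_sum_sq
  -- Substituting `x = (1, u/s, v/s)` undoes the scaling in the octic and moves it into the
  -- multiplier; `y = (1, 0, 0)` removes the `K` term.
  refine h n (fun j => aeval (Sum.elim ![1, C (s : ℝ)⁻¹ * X 0, C (s : ℝ)⁻¹ * X 1] ![1, 0, 0]) (Q j))
    fun u v => ?_
  have he : ∀ p : MvPolynomial (Fin 3 ⊕ Fin 3) ℝ, eval ![u, v]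
      (aeval (Sum.elim ![1, C (s : ℝ)⁻¹ * X 0, C (s : ℝ)⁻¹ * X 1] ![1, 0, 0]) p)
      = eval (Sum.elim ![1, (s : ℝ)⁻¹ * u, (s : ℝ)⁻¹ * v] ![1, 0, 0]) p := by
    intro p
    have : (eval ![u, v]).comp ((aeval (Sum.elim
        ![1, C (s : ℝ)⁻¹ * X 0, C (s : ℝ)⁻¹ * X 1] ![1, 0, 0]) :
          MvPolynomial (Fin 3 ⊕ Fin 3) ℝ →ₐ[ℝ] MvPolynomial (Fin 2) ℝ) : _ →+* _)
        = eval (Sum.elim ![1, (s : ℝ)⁻¹ * u, (s : ℝ)⁻¹ * v] ![1, 0, 0]) := by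
      ext i
      · simp
      · rcases i with i | i <;> fin_cases i <;> simp
    exact congr($this p)
  have h1 := congrArg (eval (Sum.elim ![1, (s : ℝ)⁻¹ * u, (s : ℝ)⁻¹ * v] ![1, 0, 0])) hQ
  rw [map_mul, eval_hessianBiform, hessianAt_octic] at h1
  simp only [he]
  simp only [map_sum, map_pow] at h1
  rw [← h1]
  simp [Fin.sum_univ_three, mainBiform, radialBiform, hs0]
  left
  congr 1
  ring

lemma IsRSosConvex.mono {n r r' : ℕ} (h : r ≤ r') {f : MvPolynomial (Fin n) ℝ}
    (hf : IsRSosConvex r f) : IsRSosConvex r' f := by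
  have h2 : ∀ k : ℕ, IsSumSq
      ((∑ i : Fin n, (X (Sum.inl i) : MvPolynomial (Fin n ⊕ Fin n) ℝ) ^ 2) ^ k) := by
    intro k
    induction k with
    | zero => simp
    | succ k ih =>
      rw [pow_succ]
      exact ih.mul (IsSumSq.sum_sq _ _)
  obtain ⟨k, rfl⟩ := Nat.exists_eq_add_of_le h
  have h3 := IsSumSq.mul hf (h2 k)
  rwa [mul_assoc, ← pow_add] at h3

end

end PolyNorm

theorem mainTheorem7 :
    -- for every `r` there is a trivariate octic form with positive definite Hessian away from
    -- the origin that is not `r`-sos-convex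
    (∀ r : ℕ, ∃ f : MvPolynomial (Fin 3) ℝ,
      f.IsHomogeneous 8 ∧ PolyNorm.HasPosDefHessian f ∧ ¬ PolyNorm.IsRSosConvex r f) ∧
    -- these forms can be taken to be rescalings of one fixed octic
    (∃ f : MvPolynomial (Fin 3) ℝ,
      f.IsHomogeneous 8 ∧ PolyNorm.HasPosDefHessian f ∧
      ∀ r : ℕ, ∃ s : ℕ, 1 ≤ s ∧
        (PolyNorm.rescale s f).IsHomogeneous 8 ∧
        PolyNorm.HasPosDefHessian (PolyNorm.rescale s f) ∧
        ¬ PolyNorm.IsRSosConvex r (PolyNorm.rescale s f)) ∧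
    -- the level cannot be bounded in terms of the number of variables and the degree alone
    (¬ ∃ R : ℕ → ℕ → ℕ, ∀ (n d : ℕ) (f : MvPolynomial (Fin n) ℝ),
      f.IsHomogeneous d → PolyNorm.HasPosDefHessian f →
        ∃ r : ℕ, r ≤ R n d ∧ PolyNorm.IsRSosConvex r f) := by
  obtain ⟨K, hK⟩ := PolyNorm.exists_octic_hasPosDefHessian
  have h1 : ∀ r : ℕ, ∃ f : MvPolynomial (Fin 3) ℝ,
      f.IsHomogeneous 8 ∧ PolyNorm.HasPosDefHessian f ∧ ¬ PolyNorm.IsRSosConvex r f := fun r => by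
    obtain ⟨s, hs, h⟩ := PolyNorm.exists_not_isRSosConvex_octic K r
    exact ⟨_, PolyNorm.octic_isHomogeneous K s, hK s (by positivity), h⟩
  refine ⟨h1, ⟨PolyNorm.octic K 1, PolyNorm.octic_isHomogeneous K 1, hK 1 one_ne_zero,
    fun r => ?_⟩, ?_⟩
  · obtain ⟨s, hs, h⟩ := PolyNorm.exists_not_isRSosConvex_octic K r
    refine ⟨s, hs, ?_⟩
    rw [PolyNorm.rescale_octic]
    exact ⟨PolyNorm.octic_isHomogeneous K s, hK s (by positivity), h⟩
  · rintro ⟨R, hR⟩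
    obtain ⟨f, hf, hpos, hn⟩ := h1 (R 3 8)
    obtain ⟨r, hr, hsos⟩ := hR 3 8 f hf hpos
    exact hn (hsos.mono hr)
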